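/- An \emph{infinite frieze} of positive integers is an array $(m_{ij})_{i,j\in\mathbb{Z},\, j\ge i-2}$ of integers with $m_{i,i-2}=0$, $m_{i,i-1}=1$ for all $i$, $m_{ij}>0$ for all $i\le j$, and $m_{ij}m_{i+1,j+1}-m_{i+1,j}m_{i,j+1}=1$ for all $i,j$ with $j\ge i-1$. Its \emph{quiddity row} is $(a_i)_{i\in\mathbb{Z}}$ with $a_i=m_{ii}$. For $A\subseteq\mathbb{Q}$ let $\mathbb{V}_A$ be the strip $\mathbb{R}\times[0,1]$ with marked points $(i,0)$, $i\in\mathbb{Z}$, on the lower boundary and $(q,1)$, $q\in A$, on the upper boundary, together with two limit points $-\infty$ and $+\infty$ at its left and right extremities. An \emph{arc} of $\mathbb{V}_A$ is a curve without self-intersections in the interior of the strip that joins two distinct points among the marked points and the limit points $\pm\infty$, considered up to isotopy fixing the end points; boundary segments, i.e. segments between neighbouring marked points on the same boundary line, are not arcs. (Thus an arc joins two marked points, or a marked point and a limit point, or the two limit points; it is determined by its end points.) Two arcs are \emph{compatible} if they have representatives that do not intersect except possibly at common end points. A \emph{triangulation} of $\mathbb{V}_A$ is a maximal collection of pairwise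 compatible arcs; it is \emph{admissible} if each lower marked point $(i,0)$ is an end point of only finitely many of its arcs. A \emph{triangle} of a triangulation $T$ is given by three distinct points among the marked points and limit points such that any two of them are joined by an arc of $T$ or by a boundary segment. \textbf{Theorem.} Every infinite frieze of positive integers is realizable in the infinite strip: if $(a_i)_{i\in\mathbb{Z}}$ is its quiddity row, then there are a set $A\subseteq\mathbb{Q}$ and an admissible triangulation of $\mathbb{V}_A$ such that, for every $i\in\mathbb{Z}$, the number of triangles incident with $(i,0)$ is equal to $a_i$. -/

import Mathlib

open Filter Topology Set

/-- An infinite frieze of positive integers: an array `m i j`, where only the entries with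
`i - 2 ≤ j` belong to the frieze (the other values of `m` are irrelevant), satisfying the
unimodular rule on every diamond `m i j`, `m (i+1) j`, `m i (j+1)`, `m (i+1) (j+1)` all of
whose entries belong to the frieze. -/
structure IsInfiniteFrieze (m : ℤ → ℤ → ℤ) : Prop where
  zero_row : ∀ i, m i (i - 2) = 0
  one_row : ∀ i, m i (i - 1) = 1
  pos : ∀ i j, i ≤ j → 0 < m i j
  unimodular : ∀ i j, i - 1 ≤ j → m i j * m (i + 1) (j + 1) - m (i + 1) j * m i (j + 1) = 1

/-- The quiddity row of a frieze. -/
def quiddityRow (m : ℤ → ℤ → ℤ) (i : ℤ) : ℤ := m i i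

namespace Strip

/-- The possible end points of arcs in the strip `ℝ × [0, 1]`: the points `(i, 0)` with `i`
an integer, the points `(q, 1)` with `q` rational, and the two limit points `-∞` and `+∞` at
the left and right extremities of the strip. -/
inductive Pt : Type
  | lower (i : ℤ)
  | upper (q : ℚ)
  | negInf
  | posInf

/-- The end points that are available when `{(q, 1) | q ∈ A}` is the set of marked points on
the upper boundary. -/
def Pt.Available (A : Set ℚ) : Pt → Prop
  | .lower _ => True
  | .upper q => q ∈ A
  | .negInf => True
  | .posInf => True

/-- The neighbourhoods, in the plane, of an end point. A neighbourhood of `±∞` contains all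
points whose first coordinate is close enough to `±∞`. -/
def Pt.nhds : Pt → Filter (ℝ × ℝ)
  | .lower i => 𝓝 ((i : ℝ), (0 : ℝ))
  | .upper q => 𝓝 ((q : ℝ), (1 : ℝ))
  | .negInf => comap Prod.fst atBot
  | .posInf => comap Prod.fst atTop

/-- `γ`, restricted to the open interval `(0, 1)`, is a curve without self-intersections inside
the open strip `ℝ × (0, 1)` that starts at `x` and ends at `y`. -/
structure IsCurve (γ : ℝ → ℝ × ℝ) (x y : Pt) : Prop where
  continuousOn : ContinuousOn γ (Ioo 0 1)
  injOn : InjOn γ (Ioo 0 1)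
  mem_strip : ∀ t ∈ Ioo (0 : ℝ) 1, (γ t).2 ∈ Ioo (0 : ℝ) 1
  tendsto_start : Tendsto γ (𝓝[>] 0) x.nhds
  tendsto_end : Tendsto γ (𝓝[<] 1) y.nhds

/-- The segments of the boundary between neighbouring marked points of the same boundary line. -/
def IsBoundarySegment (A : Set ℚ) (e : Sym2 Pt) : Prop :=
  (∃ i : ℤ, e = s(.lower i, .lower (i + 1))) ∨
  (∃ p ∈ A, ∃ q ∈ A, p < q ∧ (∀ r ∈ A, ¬ (p < r ∧ r < q)) ∧ e = s(.upper p, .upper q))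

/-- Arcs, up to isotopy fixing the end points. The strip is simply connected, so that an
isotopy class is given by its two end points, which are distinct; boundary segments are not
arcs. This comprises peripheral arcs (both end points on the same boundary line), bridging arcs
(one on each), asymptotic arcs (from a marked point to `-∞` or to `+∞`), and the generic arc
`s(negInf, posInf)`. -/
def IsArc (A : Set ℚ) (e : Sym2 Pt) : Prop :=
  ¬ e.IsDiag ∧ (∀ x ∈ e, x.Available A) ∧ ¬ IsBoundarySegment A e

/-- `γ` is a representative of the isotopy class with end points `e`. -/
def Represents (γ : ℝ → ℝ × ℝ) (e : Sym2 Pt) : Prop :=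
  ∃ x y : Pt, e = s(x, y) ∧ IsCurve γ x y

/-- Two arcs are compatible if they have representatives that do not intersect (except possibly
in common end points). -/
def Compatible (e f : Sym2 Pt) : Prop :=
  ∃ γ δ : ℝ → ℝ × ℝ, Represents γ e ∧ Represents δ f ∧
    Disjoint (γ '' Ioo 0 1) (δ '' Ioo 0 1)

/-- A triangulation is a maximal collection of pairwise compatible arcs. -/
def IsTriangulation (A : Set ℚ) (T : Set (Sym2 Pt)) : Prop :=
  Maximal (fun S : Set (Sym2 Pt) => (∀ e ∈ S, IsArc A e) ∧ S.Pairwise Compatible) T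

/-- A triangulation is admissible if every vertex on the lower boundary is incident with only
finitely many arcs. -/
def IsAdmissibleTriangulation (A : Set ℚ) (T : Set (Sym2 Pt)) : Prop :=
  IsTriangulation A T ∧ ∀ i : ℤ, {e ∈ T | Pt.lower i ∈ e}.Finite

/-- The triangles of `T`, given by their three vertices: each of the three sides is an arc of `T`
or a boundary segment. -/
def triangles (A : Set ℚ) (T : Set (Sym2 Pt)) : Set (Finset Pt) :=
  {t | t.card = 3 ∧ ∀ x ∈ t, ∀ y ∈ t, x ≠ y → s(x, y) ∈ T ∨ IsBoundarySegment A s(x, y)}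

/-- The triangles of `T` incident with the lower vertex `(i, 0)`. -/
def trianglesAt (A : Set ℚ) (T : Set (Sym2 Pt)) (i : ℤ) : Set (Finset Pt) :=
  {t ∈ triangles A T | Pt.lower i ∈ t}

/-- The sequence `a` is realizable in the strip: for some set of marked points on the upper
boundary there is an admissible triangulation in which, for every `i`, the number of triangles
incident with `(i, 0)` is finite and equal to `a i`. -/
def Realizable (a : ℤ → ℤ) : Prop :=
  ∃ (A : Set ℚ) (T : Set (Sym2 Pt)), IsAdmissibleTriangulation A T ∧
    ∀ i : ℤ, (trianglesAt A T i).Finite ∧ ((trianglesAt A T i).ncard : ℤ) = a i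

end Strip

/-!
Compactify the strip to a closed disc, with the limit points `±∞` at `±1`. Two arcs are then
compatible exactly when the chords with the same end points do not cross: disjoint curves cannot
join linked pairs of boundary points, and chords that do not cross can be pulled back to the strip.

The entries of a frieze are the determinants of pairs of vectors `v j` in `ℤ²` that wind in the
positive direction and satisfy `v (j + 1) = a j • v j - v (j - 1)`. Take as upper marked points the
rational directions that come after all `v j`. The Farey edges, which join marked points whose
primitive vectors have determinant `±1`, do not cross by Ptolemy's relation, and hence extend to a
triangulation. The vectors `v (i + 1) - k • v i` with `0 ≤ k ≤ a i` lead from `v (i + 1)` to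
`-v (i - 1)`, form a basis with `v i`, and consecutive ones form a basis: up to sign they belong to
marked points, which cut out a fan of `a i` triangles around `(i, 0)`. No arc can end at `(i, 0)`
inside the fan, and so these are all of the triangles there.
-/

/-! ### Linked pairs of points on the unit circle -/

namespace Strip

theorem arg_one_sub_exp {θ : ℝ} (h₀ : 0 < θ) (h₁ : θ < 2 * Real.pi) :
    (1 - (Circle.exp θ : ℂ)).arg = (θ - Real.pi) / 2 := by
  have hsin : 0 < 2 * Real.sin (θ / 2) :=
    mul_pos two_pos (Real.sin_pos_of_pos_of_lt_pi (by linarith) (by linarith))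
  have hpolar : 1 - (Circle.exp θ : ℂ) = ((2 * Real.sin (θ / 2) : ℝ) : ℂ) *
      (Complex.cos ((θ - Real.pi) / 2 : ℝ) + Complex.sin ((θ - Real.pi) / 2 : ℝ) * Complex.I) := by
    have hhalf : (θ : ℂ) = 2 * (θ / 2) := by ring
    have hshift : (((θ - Real.pi) / 2 : ℝ) : ℂ) = θ / 2 - Real.pi / 2 := by push_cast; ring
    rw [hshift, Complex.cos_sub_pi_div_two, Complex.sin_sub_pi_div_two, Circle.coe_exp,
      Complex.exp_mul_I, hhalf, Complex.cos_two_mul, Complex.sin_two_mul, ← hhalf]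
    push_cast
    linear_combination (-2) * Complex.sin_sq_add_cos_sq (θ / 2 : ℂ)
  rw [hpolar, Complex.arg_mul_cos_add_sin_mul_I hsin]
  constructor <;> linarith

theorem one_sub_mem_slitPlane {w : ℂ} (h : ‖w‖ ≤ 1) (hne : w ≠ 1) : 1 - w ∈ Complex.slitPlane := by
  refine Or.inl ?_
  rw [Complex.sub_re, Complex.one_re, sub_pos]
  refine lt_of_le_of_ne ((Complex.re_le_norm w).trans h) fun hre => hne ?_
  have him : w.im = 0 := by
    have := Complex.normSq_eq_norm_sq w
    rw [Complex.normSq_apply, hre] at this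
    nlinarith [norm_nonneg w]
  exact Complex.ext hre him

theorem sub_eq_log_sub_log {K : ℝ → ℂ} (hK : Continuous K) {κ : ℂ}
    (hslit : ∀ t, κ * Complex.exp (K t) ∈ Complex.slitPlane) (s t : ℝ) :
    K t - K s = Complex.log (κ * Complex.exp (K t)) - Complex.log (κ * Complex.exp (K s)) := by
  have hconst := Complex.isCoveringMap_exp.isSeparatedMap.const_of_comp
    Complex.isCoveringMap_exp.isLocalHomeomorph.isLocallyInjective
    (g := fun t => Complex.log (κ * Complex.exp (K t)) - K t)
    ((Continuous.clog (by fun_prop) hslit).sub hK) (fun a a' => Subtype.ext (by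
      simp only [Complex.exp_sub, Complex.exp_log (Complex.slitPlane_ne_zero (hslit _)),
        mul_div_cancel_right₀ _ (Complex.exp_ne_zero _)])) t s
  linear_combination -hconst

/-- Seen from a point of the unit circle, a path in the closed disc turns by the inscribed angle. -/
theorem im_sub_of_exp_eq {K z : ℝ → ℂ} (hK : Continuous K) {κ : ℂ} {θ α β : ℝ} (hκ : κ ≠ 0)
    (hexp : ∀ t, Complex.exp (K t) = κ * (Circle.exp θ - z t))
    (hnorm : ∀ t, ‖z t‖ ≤ 1) (h₀ : z 0 = Circle.exp α) (h₁ : z 1 = Circle.exp β)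
    (hα : θ < α ∧ α < θ + 2 * Real.pi) (hβ : θ < β ∧ β < θ + 2 * Real.pi) :
    (K 1).im - (K 0).im = (β - α) / 2 := by
  set u : ℂ := (Circle.exp (-θ) : ℂ) with hu
  have hu1 : (Circle.exp θ : ℂ) * u = 1 := by
    rw [hu, ← Circle.coe_mul, ← Circle.exp_add, add_neg_cancel, Circle.exp_zero, Circle.coe_one]
  have hrot : ∀ t, u / κ * Complex.exp (K t) = 1 - z t * u := fun t => by
    rw [hexp]
    field_simp
    linear_combination hu1
  have hslit : ∀ t, u / κ * Complex.exp (K t) ∈ Complex.slitPlane := fun t => by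
    have hne : z t ≠ Circle.exp θ := fun h => Complex.exp_ne_zero (K t) (by rw [hexp, h]; simp)
    rw [hrot]
    refine one_sub_mem_slitPlane (by simpa [hu] using hnorm t) fun h => hne ?_
    linear_combination (Circle.exp θ : ℂ) * h - z t * hu1
  have harg : ∀ {t γ : ℝ}, z t = Circle.exp γ → θ < γ ∧ γ < θ + 2 * Real.pi →
      (u / κ * Complex.exp (K t)).arg = (γ - θ - Real.pi) / 2 := fun {t γ} ht hγ => by
    rw [hrot, ht, hu, ← Circle.coe_mul, ← Circle.exp_add, ← sub_eq_add_neg]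
    exact arg_one_sub_exp (by linarith [hγ.1]) (by linarith [hγ.2])
  have hlog := congrArg Complex.im (sub_eq_log_sub_log hK hslit 0 1)
  rw [Complex.sub_im, Complex.sub_im, Complex.log_im, Complex.log_im, harg h₀ hα,
    harg h₁ hβ] at hlog
  rw [hlog]
  ring

/-- Otherwise `g s - h t` has a continuous logarithm on the square, but going around the boundary
of the square its imaginary part changes by `2π`. -/
theorem exists_eq_of_linked {a b c d : ℝ} (hac : a < c) (hcb : c < b) (hbd : b < d)
    (hda : d < a + 2 * Real.pi) (g : Path (Circle.exp a : ℂ) (Circle.exp b))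
    (h : Path (Circle.exp c : ℂ) (Circle.exp d)) (hg : ∀ s, ‖g s‖ ≤ 1) (hh : ∀ t, ‖h t‖ ≤ 1) :
    ∃ s t, g s = h t := by
  by_contra! hne
  have hsub : ∀ p : ℝ × ℝ, g.extend p.1 - h.extend p.2 ≠ 0 := fun p => sub_ne_zero.2 (hne _ _)
  obtain ⟨L, ⟨-, hL⟩, -⟩ := Complex.isCoveringMapOn_exp.existsUnique_continuousMap_lifts
    (⟨fun p => g.extend p.1 - h.extend p.2, by fun_prop⟩ : C(ℝ × ℝ, ℂ))
    (Complex.exp_log (hsub 0)) hsub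
  have hL : ∀ s t, Complex.exp (L (s, t)) = g.extend s - h.extend t := fun s t => congrFun hL (s, t)
  have left := im_sub_of_exp_eq (K := fun t => L (0, t)) (z := h.extend) (κ := 1) (θ := a) (α := c)
    (β := d) (by fun_prop) one_ne_zero (fun t => by rw [hL, g.extend_zero, one_mul])
    (fun _ => hh _) h.extend_zero h.extend_one ⟨by linarith, by linarith⟩ ⟨by linarith, by linarith⟩
  have right := im_sub_of_exp_eq (K := fun t => L (1, t)) (z := h.extend) (κ := 1) (θ := b)
    (α := c + 2 * Real.pi) (β := d) (by fun_prop) one_ne_zero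
    (fun t => by rw [hL, g.extend_one, one_mul]) (fun _ => hh _)
    (by rw [h.extend_zero, Circle.exp_add_two_pi]) h.extend_one
    ⟨by linarith, by linarith⟩ ⟨by linarith, by linarith⟩
  have bottom := im_sub_of_exp_eq (K := fun s => L (s, 0)) (z := g.extend) (κ := -1) (θ := c)
    (α := a + 2 * Real.pi) (β := b) (by fun_prop) (by simp)
    (fun s => by rw [hL, h.extend_zero]; ring) (fun _ => hg _)
    (by rw [g.extend_zero, Circle.exp_add_two_pi]) g.extend_one
    ⟨by linarith, by linarith⟩ ⟨by linarith, by linarith⟩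
  have top := im_sub_of_exp_eq (K := fun s => L (s, 1)) (z := g.extend) (κ := -1) (θ := d)
    (α := a + 2 * Real.pi) (β := b + 2 * Real.pi) (by fun_prop) (by simp)
    (fun s => by rw [hL, h.extend_one]; ring) (fun _ => hg _)
    (by rw [g.extend_zero, Circle.exp_add_two_pi]) (by rw [g.extend_one, Circle.exp_add_two_pi])
    ⟨by linarith, by linarith⟩ ⟨by linarith, by linarith⟩
  linarith [Real.pi_pos]

/-! ### The cyclic order of the end points -/

/-- The angle, in `[-π, π)`, at which an end point sits on the unit circle when the strip is
compactified to the closed disc with `±∞` at `±1`, the lower boundary below and the upper boundary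
above the real axis. -/
noncomputable def angle : Pt → ℝ
  | .lower i => Real.arctan i - Real.pi / 2
  | .upper q => Real.pi / 2 - Real.arctan q
  | .negInf => -Real.pi
  | .posInf => 0

theorem neg_pi_le_angle (x : Pt) : -Real.pi ≤ angle x := by
  cases x with
  | lower i => simp only [angle]; linarith [Real.neg_pi_div_two_lt_arctan i, Real.pi_pos]
  | upper q => simp only [angle]; linarith [Real.arctan_lt_pi_div_two q, Real.pi_pos]
  | negInf => exact le_rfl
  | posInf => simp only [angle]; linarith [Real.pi_pos]

theorem angle_lt_pi (x : Pt) : angle x < Real.pi := by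
  cases x with
  | lower i => simp only [angle]; linarith [Real.arctan_lt_pi_div_two i, Real.pi_pos]
  | upper q => simp only [angle]; linarith [Real.neg_pi_div_two_lt_arctan q, Real.pi_pos]
  | negInf => simp only [angle]; linarith [Real.pi_pos]
  | posInf => exact Real.pi_pos

theorem angle_lower_neg (i : ℤ) : angle (.lower i) < 0 := by
  simp only [angle]; linarith [Real.arctan_lt_pi_div_two i]

theorem neg_pi_lt_angle_lower (i : ℤ) : -Real.pi < angle (.lower i) := by
  simp only [angle]; linarith [Real.neg_pi_div_two_lt_arctan i]

theorem angle_upper_pos (q : ℚ) : 0 < angle (.upper q) := by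
  simp only [angle]; linarith [Real.arctan_lt_pi_div_two q]

theorem angle_injective : Function.Injective angle := by
  intro x y h
  rcases x with i | q | _ | _ <;> rcases y with j | r | _ | _
  case lower.lower => simpa [angle] using h
  case upper.upper => simpa [angle] using h
  all_goals first | rfl | exfalso
  all_goals
    try have := angle_lower_neg i
    try have := neg_pi_lt_angle_lower i
    try have := angle_lower_neg j
    try have := neg_pi_lt_angle_lower j
    try have := angle_upper_pos q
    try have := angle_upper_pos r
    simp only [angle] at *
    linarith [Real.pi_pos]

/-- The order of the boundary circle, cut open at `-∞`. -/
noncomputable instance : LinearOrder Pt := LinearOrder.lift' angle angle_injective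

noncomputable instance : CircularOrder Pt := LinearOrder.toCircularOrder Pt

theorem lt_iff_angle_lt {x y : Pt} : x < y ↔ angle x < angle y := Iff.rfl

theorem sbtw_iff {x y z : Pt} : sbtw x y z ↔ x < y ∧ y < z ∨ y < z ∧ z < x ∨ z < x ∧ x < y :=
  Iff.rfl

theorem lower_lt_lower {i j : ℤ} : Pt.lower i < .lower j ↔ i < j := by
  simp [lt_iff_angle_lt, angle]

theorem upper_lt_upper {p q : ℚ} : Pt.upper p < .upper q ↔ q < p := by
  simp [lt_iff_angle_lt, angle]

theorem lower_lt_upper (i : ℤ) (q : ℚ) : Pt.lower i < .upper q :=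
  (angle_lower_neg i).trans (angle_upper_pos q)

theorem negInf_lt_lower (i : ℤ) : Pt.negInf < .lower i := neg_pi_lt_angle_lower i

theorem lower_lt_posInf (i : ℤ) : Pt.lower i < .posInf := angle_lower_neg i

theorem posInf_lt_upper (q : ℚ) : Pt.posInf < .upper q := angle_upper_pos q

/-- The end points of one pair separate the end points of the other on the boundary circle. -/
def Crosses (e f : Sym2 Pt) : Prop :=
  ∃ x y u v, e = s(x, y) ∧ f = s(u, v) ∧ sbtw x u y ∧ sbtw y v x

theorem crosses_mk_iff {x y u v : Pt} :
    Crosses s(x, y) s(u, v) ↔ sbtw x u y ∧ sbtw y v x ∨ sbtw x v y ∧ sbtw y u x := by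
  constructor
  · rintro ⟨x', y', u', v', he, hf, hu, hv⟩
    rcases Sym2.eq_iff.1 he with ⟨rfl, rfl⟩ | ⟨rfl, rfl⟩ <;>
      rcases Sym2.eq_iff.1 hf with ⟨rfl, rfl⟩ | ⟨rfl, rfl⟩
    exacts [.inl ⟨hu, hv⟩, .inr ⟨hu, hv⟩, .inr ⟨hv, hu⟩, .inl ⟨hv, hu⟩]
  · rintro (⟨hu, hv⟩ | ⟨hv, hu⟩)
    exacts [⟨x, y, u, v, rfl, rfl, hu, hv⟩, ⟨x, y, v, u, rfl, Sym2.eq_swap, hv, hu⟩]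

theorem Crosses.exists_lt {e f : Sym2 Pt} (h : Crosses e f) : ∃ x u y v, x < u ∧ u < y ∧ y < v ∧
    (e = s(x, y) ∧ f = s(u, v) ∨ e = s(u, v) ∧ f = s(x, y)) := by
  obtain ⟨x, y, u, v, rfl, rfl, hu, hv⟩ := h
  rcases sbtw_iff.1 hu with ⟨h₁, h₂⟩ | ⟨h₁, h₂⟩ | ⟨h₁, h₂⟩ <;>
    rcases sbtw_iff.1 hv with ⟨h₃, h₄⟩ | ⟨h₃, h₄⟩ | ⟨h₃, h₄⟩
  case inl.inr.inr => exact ⟨x, u, y, v, h₁, h₂, h₄, .inl ⟨rfl, rfl⟩⟩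
  case inl.inr.inl => exact ⟨v, x, u, y, h₃, h₁, h₂, .inr ⟨rfl, Sym2.eq_swap⟩⟩
  case inr.inl.inl => exact ⟨u, y, v, x, h₁, h₃, h₄, .inr ⟨Sym2.eq_swap, rfl⟩⟩
  case inr.inr.inl => exact ⟨y, v, x, u, h₃, h₄, h₂, .inl ⟨Sym2.eq_swap, Sym2.eq_swap⟩⟩
  all_goals
    exfalso
    order

theorem Crosses.symm {e f : Sym2 Pt} (h : Crosses e f) : Crosses f e := by
  obtain ⟨x, y, u, v, rfl, rfl, hu, hv⟩ := h
  exact ⟨u, v, y, x, rfl, Sym2.eq_swap, (sbtw_trans_right hv hu.cyclic_right).cyclic_right,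
    (sbtw_trans_right hu hv.cyclic_right).cyclic_right⟩

theorem not_crosses_self (e : Sym2 Pt) : ¬ Crosses e e := by
  induction e with
  | _ x y => simp [crosses_mk_iff, sbtw_irrefl_left, sbtw_irrefl_right]

/-! ### The compactification of the strip -/

/-- The point of the unit circle that corresponds to an end point. -/
noncomputable def boundaryPt (x : Pt) : Circle := Circle.exp (angle x)

theorem boundaryPt_injective : Function.Injective boundaryPt := fun x y h =>
  angle_injective (Circle.exp_injOn_Ico (by linarith) ⟨neg_pi_le_angle x, angle_lt_pi x⟩
    ⟨neg_pi_le_angle y, angle_lt_pi y⟩ h)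

theorem coe_boundaryPt (x : Pt) :
    (boundaryPt x : ℂ) = Real.cos (angle x) + Real.sin (angle x) * Complex.I := by
  rw [boundaryPt, Circle.coe_exp, Complex.exp_mul_I, Complex.ofReal_cos, Complex.ofReal_sin]

/-- A homeomorphism of the strip `ℝ × [0, 1]` onto the closed unit disc without the points `±1`. -/
noncomputable def toDisc (p : ℝ × ℝ) : ℂ :=
  Real.sin (Real.arctan p.1) + ((2 * p.2 - 1) * Real.cos (Real.arctan p.1) : ℝ) * Complex.I

/-- The inverse of `toDisc`. -/
noncomputable def ofDisc (z : ℂ) : ℝ × ℝ :=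
  (Real.tan (Real.arcsin z.re), (1 + z.im / Real.cos (Real.arcsin z.re)) / 2)

theorem toDisc_re (p : ℝ × ℝ) : (toDisc p).re = Real.sin (Real.arctan p.1) := by
  rw [toDisc, Complex.add_re, Complex.ofReal_re, Complex.re_ofReal_mul, Complex.I_re, mul_zero,
    add_zero]

theorem toDisc_im (p : ℝ × ℝ) : (toDisc p).im = (2 * p.2 - 1) * Real.cos (Real.arctan p.1) := by
  rw [toDisc, Complex.add_im, Complex.ofReal_im, Complex.im_ofReal_mul, Complex.I_im, mul_one,
    zero_add]

theorem continuous_toDisc : Continuous toDisc := by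
  unfold toDisc
  fun_prop

theorem arcsin_re_toDisc (p : ℝ × ℝ) : Real.arcsin (toDisc p).re = Real.arctan p.1 := by
  rw [toDisc_re, Real.arcsin_sin (Real.neg_pi_div_two_lt_arctan _).le
    (Real.arctan_lt_pi_div_two _).le]

theorem ofDisc_toDisc : Function.LeftInverse ofDisc toDisc := fun p => by
  have hcos := (Real.cos_arctan_pos p.1).ne'
  refine Prod.ext ?_ ?_
  · rw [ofDisc, arcsin_re_toDisc, Real.tan_arctan]
  · rw [ofDisc, arcsin_re_toDisc, toDisc_im, mul_div_cancel_right₀ _ hcos]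
    ring

theorem abs_re_lt_one {z : ℂ} (hz : ‖z‖ < 1) : -1 < z.re ∧ z.re < 1 :=
  abs_lt.1 ((Complex.abs_re_le_norm z).trans_lt hz)

theorem toDisc_ofDisc {z : ℂ} (hz : ‖z‖ < 1) : toDisc (ofDisc z) = z := by
  obtain ⟨h₁, h₂⟩ := abs_re_lt_one hz
  have harctan : Real.arctan (ofDisc z).1 = Real.arcsin z.re :=
    Real.arctan_tan (Real.neg_pi_div_two_lt_arcsin.2 h₁) (Real.arcsin_lt_pi_div_two.2 h₂)
  have hcos : Real.cos (Real.arcsin z.re) ≠ 0 := harctan ▸ (Real.cos_arctan_pos _).ne'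
  refine Complex.ext ?_ ?_
  · rw [toDisc_re, harctan, Real.sin_arcsin h₁.le h₂.le]
  · rw [toDisc_im, harctan, ofDisc]
    field_simp
    ring

theorem norm_toDisc_lt_one_iff {p : ℝ × ℝ} : ‖toDisc p‖ < 1 ↔ p.2 ∈ Ioo (0 : ℝ) 1 := by
  have hcos : 0 < Real.cos (Real.arctan p.1) ^ 2 := pow_pos (Real.cos_arctan_pos _) 2
  have hnorm : ‖toDisc p‖ ^ 2 = 1 - 4 * (p.2 * (1 - p.2)) * Real.cos (Real.arctan p.1) ^ 2 := by
    rw [← Complex.normSq_eq_norm_sq, Complex.normSq_apply, toDisc_re, toDisc_im]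
    linear_combination Real.sin_sq_add_cos_sq (Real.arctan p.1)
  rw [← sq_lt_one_iff₀ (norm_nonneg _), hnorm, sub_lt_self_iff, mul_pos_iff_of_pos_right hcos,
    mul_pos_iff_of_pos_left four_pos, mul_pos_iff]
  constructor
  · rintro (⟨h₁, h₂⟩ | ⟨h₁, h₂⟩)
    · exact ⟨h₁, by linarith⟩
    · linarith
  · exact fun h => .inl ⟨h.1, by linarith [h.2]⟩

theorem continuousAt_ofDisc (p : ℝ × ℝ) : ContinuousAt ofDisc (toDisc p) := by
  have hcos : Real.cos (Real.arcsin (toDisc p).re) ≠ 0 := by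
    rw [arcsin_re_toDisc]
    exact (Real.cos_arctan_pos _).ne'
  have harcsin : Continuous fun z : ℂ => Real.arcsin z.re :=
    Real.continuous_arcsin.comp Complex.continuous_re
  have htan : ContinuousAt (fun z : ℂ => Real.tan (Real.arcsin z.re)) (toDisc p) :=
    ContinuousAt.comp (f := fun z : ℂ => Real.arcsin z.re) (Real.continuousAt_tan.2 hcos)
      harcsin.continuousAt
  exact htan.prodMk ((continuousAt_const.add (Complex.continuous_im.continuousAt.div
    (Real.continuous_cos.comp harcsin).continuousAt hcos)).div_const 2)

theorem boundaryPt_lower (i : ℤ) : (boundaryPt (.lower i) : ℂ) = toDisc (i, 0) := by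
  rw [coe_boundaryPt, toDisc, angle, Real.cos_sub_pi_div_two, Real.sin_sub_pi_div_two]
  simp

theorem boundaryPt_upper (q : ℚ) : (boundaryPt (.upper q) : ℂ) = toDisc (q, 1) := by
  rw [coe_boundaryPt, toDisc, angle, Real.cos_pi_div_two_sub, Real.sin_pi_div_two_sub]
  norm_num

theorem boundaryPt_negInf : (boundaryPt .negInf : ℂ) = (Real.sin (-(Real.pi / 2)) : ℝ) := by
  rw [coe_boundaryPt, angle]
  simp

theorem boundaryPt_posInf : (boundaryPt .posInf : ℂ) = (Real.sin (Real.pi / 2) : ℝ) := by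
  rw [coe_boundaryPt, angle]
  simp

theorem tendsto_toDisc_of_tendsto_arctan {l : Filter (ℝ × ℝ)} {φ : ℝ} (hφ : Real.cos φ = 0)
    (hl : Tendsto (fun p => Real.arctan p.1) l (𝓝 φ)) (hstrip : ∀ᶠ p in l, p.2 ∈ Ioo (0 : ℝ) 1) :
    Tendsto toDisc l (𝓝 (Real.sin φ : ℝ)) := by
  have hre : Tendsto (fun p : ℝ × ℝ => ((Real.sin (Real.arctan p.1) : ℝ) : ℂ)) l
      (𝓝 (Real.sin φ : ℝ)) :=
    ((Complex.continuous_ofReal.comp Real.continuous_sin).tendsto φ).comp hl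
  have hcos : Tendsto (fun p : ℝ × ℝ => Real.cos (Real.arctan p.1)) l (𝓝 0) :=
    hφ ▸ (Real.continuous_cos.tendsto φ).comp hl
  have him : Tendsto (fun p : ℝ × ℝ =>
      ((2 * p.2 - 1) * Real.cos (Real.arctan p.1) : ℝ) * Complex.I) l (𝓝 0) := by
    refine squeeze_zero_norm' (hstrip.mono fun p hp => ?_) hcos
    rw [norm_mul, Complex.norm_I, mul_one, Complex.norm_real, norm_mul, Real.norm_eq_abs,
      Real.norm_eq_abs, abs_of_pos (Real.cos_arctan_pos _)]
    refine mul_le_of_le_one_left (Real.cos_arctan_pos _).le (abs_le.2 ?_)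
    constructor <;> linarith [hp.1, hp.2]
  have hadd := hre.add him
  rwa [add_zero] at hadd

theorem tendsto_toDisc (x : Pt) :
    Tendsto toDisc (x.nhds ⊓ 𝓟 (Prod.snd ⁻¹' Ioo 0 1)) (𝓝 (boundaryPt x)) := by
  cases x with
  | lower i =>
    rw [boundaryPt_lower]
    exact (continuous_toDisc.tendsto _).mono_left inf_le_left
  | upper q =>
    rw [boundaryPt_upper]
    exact (continuous_toDisc.tendsto _).mono_left inf_le_left
  | negInf =>
    rw [boundaryPt_negInf]
    exact tendsto_toDisc_of_tendsto_arctan (by simp)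
      (((tendsto_nhdsWithin_iff.1 Real.tendsto_arctan_atBot).1.comp tendsto_comap).mono_left
        inf_le_left) (mem_inf_of_right (mem_principal_self _))
  | posInf =>
    rw [boundaryPt_posInf]
    exact tendsto_toDisc_of_tendsto_arctan Real.cos_pi_div_two
      (((tendsto_nhdsWithin_iff.1 Real.tendsto_arctan_atTop).1.comp tendsto_comap).mono_left
        inf_le_left) (mem_inf_of_right (mem_principal_self _))

theorem tendsto_ofDisc (x : Pt) :
    Tendsto ofDisc (𝓝 (boundaryPt x : ℂ) ⊓ 𝓟 (Metric.ball 0 1)) x.nhds := by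
  have hball : ∀ᶠ z in 𝓝 (boundaryPt x : ℂ) ⊓ 𝓟 (Metric.ball 0 1), ‖z‖ < 1 :=
    mem_inf_of_right fun z hz => mem_ball_zero_iff.1 hz
  have harcsin {φ : ℝ} (h : (boundaryPt x : ℂ) = (Real.sin φ : ℝ)) (h₁ : -(Real.pi / 2) ≤ φ)
      (h₂ : φ ≤ Real.pi / 2) : Tendsto (fun z : ℂ => Real.arcsin z.re)
      (𝓝 (boundaryPt x : ℂ) ⊓ 𝓟 (Metric.ball 0 1)) (𝓝 φ) := by
    have ht := (Real.continuous_arcsin.comp Complex.continuous_re).tendsto (boundaryPt x : ℂ)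
    rw [Function.comp_apply, h, Complex.ofReal_re, Real.arcsin_sin h₁ h₂, ← h] at ht
    exact ht.mono_left inf_le_left
  cases x with
  | lower i =>
    have h := (continuousAt_ofDisc (i, 0)).tendsto
    rw [ofDisc_toDisc, ← boundaryPt_lower] at h
    exact h.mono_left inf_le_left
  | upper q =>
    have h := (continuousAt_ofDisc (q, 1)).tendsto
    rw [ofDisc_toDisc, ← boundaryPt_upper] at h
    exact h.mono_left inf_le_left
  | negInf =>
    exact tendsto_comap_iff.2 (Real.tendsto_tan_neg_pi_div_two.comp (tendsto_nhdsWithin_iff.2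
      ⟨harcsin boundaryPt_negInf le_rfl (by linarith [Real.pi_pos]),
        hball.mono fun z hz => Real.neg_pi_div_two_lt_arcsin.2 (abs_re_lt_one hz).1⟩))
  | posInf =>
    exact tendsto_comap_iff.2 (Real.tendsto_tan_pi_div_two.comp (tendsto_nhdsWithin_iff.2
      ⟨harcsin boundaryPt_posInf (by linarith [Real.pi_pos]) le_rfl,
        hball.mono fun z hz => Real.arcsin_lt_pi_div_two.2 (abs_re_lt_one hz).2⟩))

/-! ### Compatibility of arcs -/

theorem IsCurve.exists_path {γ : ℝ → ℝ × ℝ} {x y : Pt} (h : IsCurve γ x y) :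
    ∃ g : Path (boundaryPt x : ℂ) (boundaryPt y), ∀ t, g t = boundaryPt x ∨ g t = boundaryPt y ∨
      ∃ s ∈ Ioo (0 : ℝ) 1, g t = toDisc (γ s) := by
  have hstart : Tendsto (toDisc ∘ γ) (𝓝[>] 0) (𝓝 (boundaryPt x)) :=
    (tendsto_toDisc x).comp (tendsto_inf.2 ⟨h.tendsto_start, tendsto_principal.2
      (eventually_of_mem (Ioo_mem_nhdsGT zero_lt_one) h.mem_strip)⟩)
  have hend : Tendsto (toDisc ∘ γ) (𝓝[<] 1) (𝓝 (boundaryPt y)) :=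
    (tendsto_toDisc y).comp (tendsto_inf.2 ⟨h.tendsto_end, tendsto_principal.2
      (eventually_of_mem (Ioo_mem_nhdsLT zero_lt_one) h.mem_strip)⟩)
  have hcont : ContinuousOn (toDisc ∘ γ) (Ioo 0 1) :=
    continuous_toDisc.comp_continuousOn h.continuousOn
  have hzero := eq_lim_at_left_extendFrom_Ioo zero_lt_one hstart
  have hone := eq_lim_at_right_extendFrom_Ioo zero_lt_one hend
  refine ⟨⟨⟨_, (continuousOn_Icc_extendFrom_Ioo hcont hstart hend).domRestrict⟩, hzero, hone⟩,
    fun ⟨t, ht⟩ => ?_⟩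
  rcases eq_endpoints_or_mem_Ioo_of_mem_Icc ht with rfl | rfl | ht
  exacts [.inl hzero, .inr (.inl hone), .inr (.inr ⟨t, ht, extendFrom_extends hcont t ht⟩)]

theorem Represents.exists_path {γ : ℝ → ℝ × ℝ} {x y : Pt} (h : Represents γ s(x, y)) :
    ∃ g : Path (boundaryPt x : ℂ) (boundaryPt y), ∀ t, g t = boundaryPt x ∨ g t = boundaryPt y ∨
      ∃ p ∈ γ '' Ioo 0 1, p.2 ∈ Ioo (0 : ℝ) 1 ∧ g t = toDisc p := by
  obtain ⟨u, v, he, hγ⟩ := h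
  obtain ⟨g, hg⟩ := hγ.exists_path
  have hg' (t) : g t = boundaryPt u ∨ g t = boundaryPt v ∨
      ∃ p ∈ γ '' Ioo 0 1, p.2 ∈ Ioo (0 : ℝ) 1 ∧ g t = toDisc p :=
    (hg t).imp_right <| Or.imp_right fun ⟨s, hs, hgs⟩ =>
      ⟨γ s, mem_image_of_mem γ hs, hγ.mem_strip s hs, hgs⟩
  rcases Sym2.eq_iff.1 he with ⟨rfl, rfl⟩ | ⟨rfl, rfl⟩
  · exact ⟨g, hg'⟩
  · exact ⟨g.symm, fun t => or_left_comm.1 (hg' (unitInterval.symm t))⟩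

theorem not_compatible_of_lt {x u y v : Pt} (hxu : x < u) (huy : u < y) (hyv : y < v) :
    ¬ Compatible s(x, y) s(u, v) := by
  rintro ⟨γ, δ, hγ, hδ, hdisj⟩
  obtain ⟨g, hg⟩ := hγ.exists_path
  obtain ⟨h, hh⟩ := hδ.exists_path
  have norm_le {z : ℂ} {x y : Pt} {s : Set (ℝ × ℝ)} (hz : z = boundaryPt x ∨ z = boundaryPt y ∨
      ∃ p ∈ s, p.2 ∈ Ioo (0 : ℝ) 1 ∧ z = toDisc p) : ‖z‖ ≤ 1 := by
    rcases hz with rfl | rfl | ⟨p, -, hp, rfl⟩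
    exacts [(Circle.norm_coe _).le, (Circle.norm_coe _).le, (norm_toDisc_lt_one_iff.2 hp).le]
  have boundary_ne {x y : Pt} (hne : x ≠ y) : (boundaryPt x : ℂ) ≠ boundaryPt y :=
    fun he => hne (boundaryPt_injective (Circle.ext he))
  have boundary_ne_interior (x : Pt) {p : ℝ × ℝ} (hp : p.2 ∈ Ioo (0 : ℝ) 1) :
      (boundaryPt x : ℂ) ≠ toDisc p :=
    fun he => ((norm_toDisc_lt_one_iff.2 hp).trans_eq (Circle.norm_coe (boundaryPt x)).symm).ne'
      (congrArg norm he)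
  obtain ⟨s, t, hst⟩ : ∃ s t, g s = h t := exists_eq_of_linked hxu huy hyv
    (by linarith [angle_lt_pi v, neg_pi_le_angle x]) g h (fun s => norm_le (hg s))
    (fun t => norm_le (hh t))
  rcases hg s with hs | hs | ⟨p, hp, hp', hs⟩ <;> rcases hh t with ht | ht | ⟨q, hq, hq', ht⟩ <;>
    rw [hs, ht] at hst
  · exact boundary_ne hxu.ne hst
  · exact boundary_ne (hxu.trans (huy.trans hyv)).ne hst
  · exact boundary_ne_interior _ hq' hst
  · exact boundary_ne huy.ne' hst
  · exact boundary_ne hyv.ne hst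
  · exact boundary_ne_interior _ hq' hst
  · exact boundary_ne_interior _ hp' hst.symm
  · exact boundary_ne_interior _ hp' hst.symm
  · exact hdisj.ne_of_mem hp hq (ofDisc_toDisc.injective hst)

theorem Compatible.symm {e f : Sym2 Pt} : Compatible e f → Compatible f e :=
  fun ⟨γ, δ, hγ, hδ, h⟩ => ⟨δ, γ, hδ, hγ, h.symm⟩

theorem Crosses.not_compatible {e f : Sym2 Pt} (h : Crosses e f) : ¬ Compatible e f := by
  obtain ⟨x, u, y, v, hxu, huy, hyv, ⟨rfl, rfl⟩ | ⟨rfl, rfl⟩⟩ := h.exists_lt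
  · exact not_compatible_of_lt hxu huy hyv
  · exact fun h => not_compatible_of_lt hxu huy hyv h.symm

/-- The chord of the unit disc that joins two boundary points. -/
noncomputable def chord (x y : Pt) : ℝ → ℂ := AffineMap.lineMap (boundaryPt x : ℂ) (boundaryPt y)

theorem chord_apply (x y : Pt) (t : ℝ) :
    chord x y t = (1 - t) • (boundaryPt x : ℂ) + t • (boundaryPt y : ℂ) :=
  AffineMap.lineMap_apply_module _ _ _

theorem coe_boundaryPt_injective : Function.Injective fun x => (boundaryPt x : ℂ) :=
  Subtype.val_injective.comp boundaryPt_injective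

theorem norm_chord_lt_one {x y : Pt} (h : x ≠ y) {t : ℝ} (ht : t ∈ Ioo (0 : ℝ) 1) :
    ‖chord x y t‖ < 1 := by
  rw [chord_apply]
  exact norm_combo_lt_of_ne (Circle.norm_coe _).le (Circle.norm_coe _).le
    (coe_boundaryPt_injective.ne h) (sub_pos.2 ht.2) ht.1 (sub_add_cancel _ _)

theorem isCurve_ofDisc_chord {x y : Pt} (h : x ≠ y) : IsCurve (ofDisc ∘ chord x y) x y := by
  have hcont : Continuous (chord x y) := AffineMap.lineMap_continuous
  have hnorm {t : ℝ} (ht : t ∈ Ioo (0 : ℝ) 1) : ‖chord x y t‖ < 1 := norm_chord_lt_one h ht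
  have hball {t : ℝ} (ht : t ∈ Ioo (0 : ℝ) 1) : chord x y t ∈ Metric.ball (0 : ℂ) 1 :=
    mem_ball_zero_iff.2 (hnorm ht)
  refine ⟨fun t ht => ?_, fun s hs t ht hst => ?_, fun t ht => ?_, ?_, ?_⟩
  · have hat := continuousAt_ofDisc (ofDisc (chord x y t))
    rw [toDisc_ofDisc (hnorm ht)] at hat
    exact (hat.comp hcont.continuousAt).continuousWithinAt
  · have heq := congrArg toDisc hst
    rw [Function.comp_apply, Function.comp_apply, toDisc_ofDisc (hnorm hs),
      toDisc_ofDisc (hnorm ht)] at heq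
    exact AffineMap.lineMap_injective ℝ (coe_boundaryPt_injective.ne h) heq
  · exact norm_toDisc_lt_one_iff.1 ((congrArg norm (toDisc_ofDisc (hnorm ht))).trans_lt (hnorm ht))
  · have hzero : chord x y 0 = boundaryPt x := AffineMap.lineMap_apply_zero _ _
    exact (tendsto_ofDisc x).comp (tendsto_inf.2
      ⟨(hzero ▸ hcont.tendsto 0).mono_left nhdsWithin_le_nhds, tendsto_principal.2
        (eventually_of_mem (Ioo_mem_nhdsGT zero_lt_one) fun _ => hball)⟩)
  · have hone : chord x y 1 = boundaryPt y := AffineMap.lineMap_apply_one _ _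
    exact (tendsto_ofDisc y).comp (tendsto_inf.2
      ⟨(hone ▸ hcont.tendsto 1).mono_left nhdsWithin_le_nhds, tendsto_principal.2
        (eventually_of_mem (Ioo_mem_nhdsLT zero_lt_one) fun _ => hball)⟩)

/-- The affine functional on the plane that vanishes on the line through two boundary points. -/
noncomputable def chordForm (x y : Pt) (z : ℂ) : ℝ :=
  z.re * Real.cos ((angle x + angle y) / 2) + z.im * Real.sin ((angle x + angle y) / 2) -
    Real.cos ((angle x - angle y) / 2)

theorem chordForm_boundaryPt (x y u : Pt) : chordForm x y (boundaryPt u) =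
    -2 * Real.sin ((angle u - angle x) / 2) * Real.sin ((angle u - angle y) / 2) := by
  have hcos : chordForm x y (boundaryPt u) =
      Real.cos (angle u - (angle x + angle y) / 2) - Real.cos ((angle x - angle y) / 2) := by
    rw [chordForm, coe_boundaryPt, ← Complex.mk_eq_add_mul_I, Real.cos_sub]
  rw [hcos, Real.cos_sub_cos]
  ring_nf

theorem chordForm_chord (x y u v : Pt) (t : ℝ) : chordForm x y (chord u v t) =
    (1 - t) * chordForm x y (boundaryPt u) + t * chordForm x y (boundaryPt v) := by
  simp only [chordForm, chord_apply, Complex.add_re, Complex.add_im, Complex.smul_re,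
    Complex.smul_im, smul_eq_mul]
  ring

theorem sin_half_angle_sub_pos {x y : Pt} (h : x < y) :
    0 < Real.sin ((angle y - angle x) / 2) :=
  Real.sin_pos_of_pos_of_lt_pi (by linarith [lt_iff_angle_lt.1 h])
    (by linarith [angle_lt_pi y, neg_pi_le_angle x])

theorem sin_half_angle_sub_neg {x y : Pt} (h : x < y) :
    Real.sin ((angle x - angle y) / 2) < 0 := by
  rw [← neg_sub, neg_div, Real.sin_neg]
  exact neg_neg_of_pos (sin_half_angle_sub_pos h)

theorem chordForm_left (x y : Pt) : chordForm x y (boundaryPt x) = 0 := by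
  simp [chordForm_boundaryPt]

theorem chordForm_right (x y : Pt) : chordForm x y (boundaryPt y) = 0 := by
  simp [chordForm_boundaryPt]

theorem chordForm_pos {x y u : Pt} (hxu : x < u) (huy : u < y) :
    0 < chordForm x y (boundaryPt u) := by
  rw [chordForm_boundaryPt, mul_assoc]
  exact mul_pos_of_neg_of_neg (by norm_num)
    (mul_neg_of_pos_of_neg (sin_half_angle_sub_pos hxu) (sin_half_angle_sub_neg huy))

theorem chordForm_neg {x y u : Pt} (hxy : x < y) (hu : u < x ∨ y < u) :
    chordForm x y (boundaryPt u) < 0 := by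
  rw [chordForm_boundaryPt, mul_assoc]
  refine mul_neg_of_neg_of_pos (by norm_num) ?_
  rcases hu with hu | hu
  · exact mul_pos_of_neg_of_neg (sin_half_angle_sub_neg hu) (sin_half_angle_sub_neg (hu.trans hxy))
  · exact mul_pos (sin_half_angle_sub_pos (hxy.trans hu)) (sin_half_angle_sub_pos hu)

theorem chordForm_trichotomy {x y : Pt} (hxy : x < y) (u : Pt) :
    (u = x ∨ u = y) ∧ chordForm x y (boundaryPt u) = 0 ∨
      sbtw x u y ∧ 0 < chordForm x y (boundaryPt u) ∨
      sbtw y u x ∧ chordForm x y (boundaryPt u) < 0 := by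
  rcases lt_trichotomy u x with hux | rfl | hxu
  · exact .inr (.inr ⟨sbtw_iff.2 (.inr (.inl ⟨hux, hxy⟩)), chordForm_neg hxy (.inl hux)⟩)
  · exact .inl ⟨.inl rfl, chordForm_left u y⟩
  rcases lt_trichotomy u y with huy | rfl | hyu
  · exact .inr (.inl ⟨sbtw_iff.2 (.inl ⟨hxu, huy⟩), chordForm_pos hxu huy⟩)
  · exact .inl ⟨.inr rfl, chordForm_right x u⟩
  · exact .inr (.inr ⟨sbtw_iff.2 (.inr (.inr ⟨hxy, hyu⟩)), chordForm_neg hxy (.inr hyu)⟩)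

theorem crosses_of_chord_eq_chord {x y u v : Pt} (hxy : x < y) (huv : u ≠ v)
    (hne : s(x, y) ≠ s(u, v)) {s t : ℝ} (ht : t ∈ Ioo (0 : ℝ) 1)
    (hst : chord x y s = chord u v t) : Crosses s(x, y) s(u, v) := by
  have hzero : (1 - t) * chordForm x y (boundaryPt u) + t * chordForm x y (boundaryPt v) = 0 := by
    rw [← chordForm_chord, ← hst, chordForm_chord, chordForm_left, chordForm_right, mul_zero,
      mul_zero, add_zero]
  have ht₀ : 0 < t := ht.1
  have ht₁ : 0 < 1 - t := sub_pos.2 ht.2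
  rcases chordForm_trichotomy hxy u with ⟨hu, hu'⟩ | ⟨hu, hu'⟩ | ⟨hu, hu'⟩ <;>
    rcases chordForm_trichotomy hxy v with ⟨hv, hv'⟩ | ⟨hv, hv'⟩ | ⟨hv, hv'⟩
  case inl.inl =>
    rcases hu with rfl | rfl <;> rcases hv with rfl | rfl
    exacts [absurd rfl huv, absurd rfl hne, absurd Sym2.eq_swap hne, absurd rfl huv]
  case inr.inl.inr.inr => exact crosses_mk_iff.2 (.inl ⟨hu, hv⟩)
  case inr.inr.inr.inl => exact crosses_mk_iff.2 (.inr ⟨hv, hu⟩)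
  all_goals nlinarith

theorem compatible_of_not_crosses {e f : Sym2 Pt} (he : ¬ e.IsDiag) (hf : ¬ f.IsDiag)
    (hne : e ≠ f) (h : ¬ Crosses e f) : Compatible e f := by
  obtain ⟨x, y, hxy, rfl⟩ : ∃ x y, x < y ∧ e = s(x, y) := by
    induction e with
    | _ x y =>
      rcases lt_or_gt_of_ne he with hxy | hxy
      exacts [⟨x, y, hxy, rfl⟩, ⟨y, x, hxy, Sym2.eq_swap⟩]
  induction f with
  | _ u v =>
    refine ⟨_, _, ⟨x, y, rfl, isCurve_ofDisc_chord hxy.ne⟩, ⟨u, v, rfl, isCurve_ofDisc_chord hf⟩,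
      disjoint_left.2 ?_⟩
    rintro _ ⟨s, hs, rfl⟩ ⟨t, ht, hst⟩
    have heq := congrArg toDisc hst
    rw [Function.comp_apply, Function.comp_apply, toDisc_ofDisc (norm_chord_lt_one hf ht),
      toDisc_ofDisc (norm_chord_lt_one hxy.ne hs)] at heq
    exact h (crosses_of_chord_eq_chord hxy hf hne ht heq.symm)

/-! ### Triangulations and fans -/

theorem sbtw_or_sbtw_of_ne {α : Type*} [CircularOrder α] {a b c : α} (hab : a ≠ b) (hbc : b ≠ c)
    (hca : c ≠ a) : sbtw a b c ∨ sbtw a c b := by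
  rw [sbtw_iff_not_btw, sbtw_iff_not_btw, ← not_and_or]
  rintro ⟨hcba, hbca⟩
  rcases hcba.antisymm hbca.cyclic_right with h | h | h
  exacts [hbc h.symm, hab h.symm, hca h.symm]

theorem sbtw_iff_of_lt {x y z : Pt} (hxz : x < z) : sbtw x y z ↔ x < y ∧ y < z := by
  refine ⟨fun h => ?_, fun h => sbtw_iff.2 (.inl h)⟩
  rcases sbtw_iff.1 h with h | h | h
  exacts [h, absurd h.2 hxz.not_gt, absurd h.1 hxz.not_gt]

theorem not_sbtw_lower_succ (i : ℤ) (w : Pt) : ¬ sbtw (.lower i) w (.lower (i + 1)) := by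
  rw [sbtw_iff_of_lt (lower_lt_lower.2 (lt_add_one i))]
  rintro ⟨h₁, h₂⟩
  cases w with
  | lower j => exact (lower_lt_lower.1 h₁).not_ge (Int.lt_add_one_iff.1 (lower_lt_lower.1 h₂))
  | upper r => exact (lower_lt_upper _ r).not_gt h₂
  | negInf => exact (negInf_lt_lower i).not_gt h₁
  | posInf => exact (lower_lt_posInf _).not_gt h₂

theorem exists_available_of_sbtw_upper {A : Set ℚ} {p q : ℚ} {w : Pt} (hpq : p < q)
    (hA : w.Available A) (hw : sbtw (.upper q) w (.upper p)) : ∃ r ∈ A, p < r ∧ r < q := by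
  obtain ⟨h₁, h₂⟩ := (sbtw_iff_of_lt (upper_lt_upper.2 hpq)).1 hw
  cases w with
  | lower j => exact absurd h₁ (lower_lt_upper j q).not_gt
  | upper r => exact ⟨r, hA, upper_lt_upper.1 h₂, upper_lt_upper.1 h₁⟩
  | negInf => exact absurd h₁ ((negInf_lt_lower 0).trans (lower_lt_upper 0 q)).not_gt
  | posInf => exact absurd h₁ (posInf_lt_upper q).not_gt

/-- A pair of end points that may serve as a side of a triangle of `T`. -/
def IsSide (A : Set ℚ) (T : Set (Sym2 Pt)) (e : Sym2 Pt) : Prop := e ∈ T ∨ IsBoundarySegment A e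

section Sides

variable {A : Set ℚ} {T : Set (Sym2 Pt)} {e f : Sym2 Pt}

theorem IsBoundarySegment.exists_forall_not_sbtw (h : IsBoundarySegment A e) :
    ∃ x y, e = s(x, y) ∧ x.Available A ∧ y.Available A ∧
      ∀ w : Pt, w.Available A → ¬ sbtw x w y := by
  rcases h with ⟨i, rfl⟩ | ⟨p, hp, q, hq, hpq, hgap, rfl⟩
  · exact ⟨_, _, rfl, trivial, trivial, fun w _ => not_sbtw_lower_succ i w⟩
  · refine ⟨_, _, Sym2.eq_swap, hq, hp, fun w hA hw => ?_⟩
    obtain ⟨r, hr, hpr⟩ := exists_available_of_sbtw_upper hpq hA hw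
    exact hgap r hr hpr

theorem IsSide.available (hT : IsTriangulation A T) (h : IsSide A T e) :
    ∀ x ∈ e, x.Available A := by
  rcases h with h | h
  · exact (hT.prop.1 e h).2.1
  · obtain ⟨x, y, rfl, hx, hy, -⟩ := h.exists_forall_not_sbtw
    exact fun z hz => (Sym2.mem_iff.1 hz).elim (· ▸ hx) (· ▸ hy)

theorem IsBoundarySegment.not_crosses (h : IsBoundarySegment A e)
    (hf : ∀ x ∈ f, x.Available A) : ¬ Crosses e f := by
  obtain ⟨x, y, rfl, -, -, hgap⟩ := h.exists_forall_not_sbtw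
  induction f with
  | _ u v =>
    rw [crosses_mk_iff]
    rintro (⟨hu, -⟩ | ⟨hv, -⟩)
    · exact hgap u (hf u (Sym2.mem_mk_left u v)) hu
    · exact hgap v (hf v (Sym2.mem_mk_right u v)) hv

theorem IsSide.not_crosses (hT : IsTriangulation A T) (he : IsSide A T e) (hf : IsSide A T f) :
    ¬ Crosses e f := by
  intro h
  have hf' := hf.available hT
  rcases he with he | he
  · rcases hf with hf | hf
    · have hne : e ≠ f := fun hef => not_crosses_self f (hef ▸ h)
      exact h.not_compatible (hT.prop.2 he hf hne)
    · exact hf.not_crosses (hT.prop.1 e he).2.1 h.symm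
  · exact he.not_crosses hf' h

theorem exists_triangulation_superset {S : Set (Sym2 Pt)} (hArc : ∀ e ∈ S, IsArc A e)
    (hComp : S.Pairwise Compatible) : ∃ T, S ⊆ T ∧ IsTriangulation A T := by
  refine zorn_subset_nonempty {S | (∀ e ∈ S, IsArc A e) ∧ S.Pairwise Compatible}
    (fun c hc hchain _ => ⟨⋃₀ c, ⟨?_, ?_⟩, fun _ => subset_sUnion_of_mem⟩) S ⟨hArc, hComp⟩
  · exact fun e ⟨s, hs, he⟩ => (hc hs).1 e he
  · exact (pairwise_sUnion hchain.directedOn).2 fun s hs => (hc hs).2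

theorem exists_triangulation_of_not_crosses {S : Set (Sym2 Pt)} (hdiag : ∀ e ∈ S, ¬ e.IsDiag)
    (havail : ∀ e ∈ S, ∀ x ∈ e, x.Available A) (hcross : ∀ e ∈ S, ∀ f ∈ S, ¬ Crosses e f) :
    ∃ T, IsTriangulation A T ∧ ∀ e ∈ S, IsSide A T e := by
  obtain ⟨T, hST, hT⟩ := exists_triangulation_superset (A := A)
    (S := {e ∈ S | ¬ IsBoundarySegment A e})
    (fun e he => ⟨hdiag e he.1, havail e he.1, he.2⟩)
    (fun e he f hf hne => compatible_of_not_crosses (hdiag e he.1) (hdiag f hf.1) hne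
      (hcross e he.1 f hf.1))
  exact ⟨T, hT, fun e he => or_iff_not_imp_right.2 fun hb => hST ⟨he, hb⟩⟩

theorem mem_trianglesAt_iff {i : ℤ} {t : Finset Pt} : t ∈ trianglesAt A T i ↔
    ∃ y z, (y ≠ .lower i ∧ z ≠ .lower i ∧ y ≠ z) ∧ t = {.lower i, y, z} ∧
      IsSide A T s(.lower i, y) ∧ IsSide A T s(.lower i, z) ∧ IsSide A T s(y, z) := by
  constructor
  · rintro ⟨⟨hcard, hside⟩, hi⟩
    obtain ⟨y, z, hyz, he⟩ := Finset.card_eq_two.1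
      ((Finset.card_erase_of_mem hi).trans (congrArg (· - 1) hcard))
    obtain ⟨hy, hy'⟩ := Finset.mem_erase.1 (he ▸ Finset.mem_insert_self y {z})
    obtain ⟨hz, hz'⟩ := Finset.mem_erase.1
      (he ▸ Finset.mem_insert_of_mem (Finset.mem_singleton_self z))
    exact ⟨y, z, ⟨hy, hz, hyz⟩, by rw [← he, Finset.insert_erase hi],
      hside _ hi _ hy' hy.symm, hside _ hi _ hz' hz.symm, hside _ hy' _ hz' hyz⟩
  · rintro ⟨y, z, ⟨hy, hz, hyz⟩, rfl, hsy, hsz, hsyz⟩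
    refine ⟨⟨Finset.card_eq_three.2 ⟨_, _, _, hy.symm, hz.symm, hyz, rfl⟩, fun u hu v hv huv => ?_⟩,
      Finset.mem_insert_self _ _⟩
    change IsSide A T s(u, v)
    simp only [Finset.mem_insert, Finset.mem_singleton] at hu hv
    rcases hu with rfl | rfl | rfl <;> rcases hv with rfl | rfl | rfl <;>
      first
      | exact absurd rfl huv
      | assumption
      | (rw [Sym2.eq_swap]; assumption)

end Sides

/-- The points `x 0, …, x n`, in counterclockwise order from `(i + 1, 0)` to `(i - 1, 0)`, form the
outer boundary of a fan of `n` triangles with apex `(i, 0)` whose sides satisfy `P`. -/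
structure IsFan (P : Sym2 Pt → Prop) (i : ℤ) (n : ℕ) (x : ℕ → Pt) : Prop where
  first : x 0 = .lower (i + 1)
  last : x n = .lower (i - 1)
  sbtw_of_lt : ∀ k l, k < l → l ≤ n → sbtw (.lower i) (x k) (x l)
  spoke : ∀ k ≤ n, P s(.lower i, x k)
  rim : ∀ k < n, P s(x k, x (k + 1))

namespace IsFan

theorem mono {P Q : Sym2 Pt → Prop} {i : ℤ} {n : ℕ} {x : ℕ → Pt} (h : IsFan P i n x)
    (hPQ : ∀ e, P e → Q e) : IsFan Q i n x :=
  { h with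
    spoke := fun k hk => hPQ _ (h.spoke k hk)
    rim := fun k hk => hPQ _ (h.rim k hk) }

variable {P : Sym2 Pt → Prop} {A : Set ℚ} {T : Set (Sym2 Pt)} {i : ℤ} {n : ℕ} {x : ℕ → Pt}

theorem ne_apex (h : IsFan P i n x) {k : ℕ} (hk : k ≤ n) : x k ≠ .lower i := by
  rcases hk.lt_or_eq with hk | rfl
  · exact fun he => sbtw_irrefl_left (he ▸ h.sbtw_of_lt k n hk le_rfl)
  · rw [h.last, Ne, Pt.lower.injEq]
    omega

theorem ne_of_lt (h : IsFan P i n x) {k l : ℕ} (hkl : k < l) (hl : l ≤ n) : x k ≠ x l :=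
  fun he => sbtw_irrefl_right (he ▸ h.sbtw_of_lt k l hkl hl)

theorem exists_eq_of_isSide (hT : IsTriangulation A T) (h : IsFan (IsSide A T) i n x) {y : Pt}
    (hy : y ≠ .lower i) (hside : IsSide A T s(.lower i, y)) : ∃ k ≤ n, x k = y := by
  by_contra! hne
  have hafter {k : ℕ} (hk : k ≤ n) (hbefore : ¬ sbtw (.lower i) y (x k)) :
      sbtw (.lower i) (x k) y :=
    (sbtw_or_sbtw_of_ne (h.ne_apex hk).symm (hne k hk) hy).resolve_right hbefore
  have hall (k : ℕ) (hk : k ≤ n) : sbtw (.lower i) (x k) y := by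
    induction k with
    | zero => exact hafter hk (h.first ▸ not_sbtw_lower_succ i y)
    | succ k ih =>
      exact hafter hk fun hbefore => hside.not_crosses hT (h.rim k hk)
        (crosses_mk_iff.2 (.inl ⟨ih (Nat.le_of_succ_le hk), hbefore.cyclic_left⟩))
  have hlast : sbtw (.lower (i - 1)) y (.lower (i - 1 + 1)) := by
    rw [sub_add_cancel, ← h.last]
    exact (hall n le_rfl).cyclic_left
  exact not_sbtw_lower_succ _ y hlast

theorem eq_succ_of_isSide (hT : IsTriangulation A T) (h : IsFan (IsSide A T) i n x) {k l : ℕ}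
    (hkl : k < l) (hl : l ≤ n) (hside : IsSide A T s(x k, x l)) : l = k + 1 := by
  by_contra hne
  have hlt : k + 1 < l := lt_of_le_of_ne hkl (Ne.symm hne)
  exact (h.spoke (k + 1) (hlt.le.trans hl)).not_crosses hT hside (crosses_mk_iff.2 (.inl
    ⟨h.sbtw_of_lt k (k + 1) k.lt_succ_self (hlt.le.trans hl),
      (h.sbtw_of_lt (k + 1) l hlt hl).cyclic_left⟩))

theorem finite_arcs (hT : IsTriangulation A T) (h : IsFan (IsSide A T) i n x) :
    {e ∈ T | Pt.lower i ∈ e}.Finite := by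
  refine ((finite_Iic n).image fun k => s(Pt.lower i, x k)).subset ?_
  rintro _ ⟨he, y, rfl⟩
  have hy : y ≠ .lower i := fun hy => (hT.prop.1 _ he).1 hy.symm
  obtain ⟨k, hk, rfl⟩ := h.exists_eq_of_isSide hT hy (.inl he)
  exact mem_image_of_mem _ hk

theorem trianglesAt_eq (hT : IsTriangulation A T) (h : IsFan (IsSide A T) i n x) :
    trianglesAt A T i = (fun k => {.lower i, x k, x (k + 1)}) '' Iio n := by
  ext t
  rw [mem_trianglesAt_iff]
  constructor
  · rintro ⟨y, z, ⟨hy, hz, hyz⟩, rfl, hsy, hsz, hsyz⟩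
    obtain ⟨k, hk, rfl⟩ := h.exists_eq_of_isSide hT hy hsy
    obtain ⟨l, hl, rfl⟩ := h.exists_eq_of_isSide hT hz hsz
    rcases lt_trichotomy k l with hkl | rfl | hlk
    · obtain rfl := h.eq_succ_of_isSide hT hkl hl hsyz
      exact ⟨k, hl, rfl⟩
    · exact absurd rfl hyz
    · obtain rfl := h.eq_succ_of_isSide hT hlk hk (Sym2.eq_swap ▸ hsyz)
      exact ⟨l, hk, congrArg _ (Finset.pair_comm _ _)⟩
  · rintro ⟨k, hk : k < n, rfl⟩
    exact ⟨x k, x (k + 1), ⟨h.ne_apex hk.le, h.ne_apex hk, h.ne_of_lt k.lt_succ_self hk⟩, rfl,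
      h.spoke k hk.le, h.spoke (k + 1) hk, h.rim k hk⟩

theorem injOn_triangle (h : IsFan P i n x) :
    InjOn (fun k => ({.lower i, x k, x (k + 1)} : Finset Pt)) (Iio n) := by
  have hne {k l : ℕ} (hkl : k < l) (hl : l < n) :
      x k ∉ ({.lower i, x l, x (l + 1)} : Finset Pt) := by
    simp only [Finset.mem_insert, Finset.mem_singleton, not_or]
    exact ⟨h.ne_apex (hkl.trans hl).le, h.ne_of_lt hkl hl.le,
      h.ne_of_lt (hkl.trans l.lt_succ_self) hl⟩
  have hmem (k : ℕ) : x k ∈ ({.lower i, x k, x (k + 1)} : Finset Pt) :=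
    Finset.mem_insert_of_mem (Finset.mem_insert_self _ _)
  intro k hk l hl (he : ({_, _, _} : Finset Pt) = {_, _, _})
  rcases lt_trichotomy k l with hkl | hkl | hlk
  exacts [absurd (he ▸ hmem k) (hne hkl hl), hkl, absurd (he.symm ▸ hmem l) (hne hlk hk)]

theorem finite_trianglesAt (hT : IsTriangulation A T) (h : IsFan (IsSide A T) i n x) :
    (trianglesAt A T i).Finite :=
  h.trianglesAt_eq hT ▸ (finite_Iio n).image _

theorem ncard_trianglesAt (hT : IsTriangulation A T) (h : IsFan (IsSide A T) i n x) :
    (trianglesAt A T i).ncard = n := by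
  rw [h.trianglesAt_eq hT, h.injOn_triangle.ncard_image, ← Finset.coe_Iio,
    ncard_coe_finset, Nat.card_Iio]

end IsFan

end Strip

/-! ### The extended frieze -/

namespace IsInfiniteFrieze

variable {m : ℤ → ℤ → ℤ}

theorem pos_of_sub_one_le (hm : IsInfiniteFrieze m) {i j : ℤ} (h : i - 1 ≤ j) : 0 < m i j := by
  rcases eq_or_lt_of_le h with rfl | h
  · rw [hm.one_row]; exact one_pos
  · exact hm.pos i j (by omega)

/-- The frieze `m` extended to an antisymmetric array on `ℤ × ℤ`. The indices are shifted by one,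
`entry m i j = m (i + 1) (j - 1)`, so that the diagonal is the row of zeros. -/
def entry (m : ℤ → ℤ → ℤ) (i j : ℤ) : ℤ :=
  if i ≤ j then m (i + 1) (j - 1) else -m (j + 1) (i - 1)

theorem entry_of_le {i j : ℤ} (h : i ≤ j) : entry m i j = m (i + 1) (j - 1) := if_pos h

theorem entry_self (hm : IsInfiniteFrieze m) (i : ℤ) : entry m i i = 0 := by
  rw [entry_of_le le_rfl, show i - 1 = i + 1 - 2 by ring, hm.zero_row]

theorem entry_swap (hm : IsInfiniteFrieze m) (i j : ℤ) : entry m j i = -entry m i j := by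
  rcases lt_trichotomy i j with h | rfl | h
  · simp [entry, h.le, h.not_ge]
  · simp [hm.entry_self]
  · simp [entry, h.le, h.not_ge]

theorem entry_succ (hm : IsInfiniteFrieze m) (i : ℤ) : entry m i (i + 1) = 1 := by
  rw [entry_of_le (by omega), add_sub_cancel_right]
  simpa using hm.one_row (i + 1)

theorem entry_pred (hm : IsInfiniteFrieze m) (i : ℤ) : entry m i (i - 1) = -1 := by
  have h := hm.entry_succ (i - 1)
  rw [sub_add_cancel] at h
  rw [hm.entry_swap, h]

theorem entry_pred_succ (m : ℤ → ℤ → ℤ) (i : ℤ) : entry m (i - 1) (i + 1) = m i i := by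
  rw [entry_of_le (by omega), sub_add_cancel, add_sub_cancel_right]

theorem entry_pos (hm : IsInfiniteFrieze m) {i j : ℤ} (h : i < j) : 0 < entry m i j := by
  rw [entry_of_le h.le]
  exact hm.pos_of_sub_one_le (by omega)

theorem entry_ne_zero (hm : IsInfiniteFrieze m) {i j : ℤ} (h : i ≠ j) : entry m i j ≠ 0 := by
  rcases h.lt_or_gt with h | h
  · exact (hm.entry_pos h).ne'
  · rw [hm.entry_swap]; exact neg_ne_zero.2 (hm.entry_pos h).ne'

theorem entry_mul_entry_succ_pos (hm : IsInfiniteFrieze m) {i j : ℤ} (h : j ≠ i)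
    (h' : j + 1 ≠ i) : 0 < entry m i j * entry m i (j + 1) := by
  rcases h.lt_or_gt with h | h
  · rw [hm.entry_swap j, hm.entry_swap (j + 1), neg_mul_neg]
    exact mul_pos (hm.entry_pos h) (hm.entry_pos (by omega))
  · exact mul_pos (hm.entry_pos h) (hm.entry_pos (by omega))

theorem entry_unimodular (hm : IsInfiniteFrieze m) (i j : ℤ) :
    entry m i j * entry m (i + 1) (j + 1) - entry m (i + 1) j * entry m i (j + 1) = 1 := by
  have of_lt {i j : ℤ} (h : i < j) :
      entry m i j * entry m (i + 1) (j + 1) - entry m (i + 1) j * entry m i (j + 1) = 1 := by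
    have := hm.unimodular (i + 1) (j - 1) (by omega)
    rw [sub_add_cancel] at this
    rw [entry_of_le h.le, entry_of_le (by omega), entry_of_le (by omega), entry_of_le (by omega),
      add_sub_cancel_right]
    exact this
  rcases lt_trichotomy i j with h | rfl | h
  · exact of_lt h
  · rw [hm.entry_swap i (i + 1), hm.entry_self, hm.entry_succ]; ring
  · rw [hm.entry_swap j i, hm.entry_swap (j + 1) (i + 1), hm.entry_swap j (i + 1),
      hm.entry_swap (j + 1) i]
    linear_combination of_lt h

theorem entry_recurrence (hm : IsInfiniteFrieze m) (i j : ℤ) :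
    entry m i (j + 1) + entry m i (j - 1) = m j j * entry m i j := by
  -- The unimodular rules to the left and to the right of column `j`.
  have rules (i : ℤ) : (entry m i (j + 1) + entry m i (j - 1)) * entry m (i + 1) j =
      entry m i j * (entry m (i + 1) (j + 1) + entry m (i + 1) (j - 1)) := by
    have hl := hm.entry_unimodular i (j - 1)
    rw [sub_add_cancel] at hl
    linear_combination hl - hm.entry_unimodular i j
  rcases lt_trichotomy i j with h | rfl | h
  · refine Int.leInductionDown (m := j - 1)
      (motive := fun i _ => entry m i (j + 1) + entry m i (j - 1) = m j j * entry m i j)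
      ?_ (fun i hi ih => ?_) i (by omega)
    · have h := hm.entry_succ (j - 1)
      rw [sub_add_cancel] at h
      rw [entry_pred_succ, hm.entry_self, h]; ring
    · have hr := rules (i - 1)
      rw [sub_add_cancel] at hr
      refine mul_right_cancel₀ (hm.entry_ne_zero (show i ≠ j by omega)) ?_
      linear_combination hr + entry m (i - 1) j * ih
  · rw [hm.entry_self, hm.entry_succ, hm.entry_pred]; ring
  · refine Int.leInduction (m := j + 1)
      (motive := fun i _ => entry m i (j + 1) + entry m i (j - 1) = m j j * entry m i j)
      ?_ (fun i hi ih => ?_) i (by omega)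
    · rw [hm.entry_self, hm.entry_swap (j - 1), entry_pred_succ, hm.entry_swap j, hm.entry_succ]
      ring
    · refine mul_left_cancel₀ (hm.entry_ne_zero (show i ≠ j by omega)) ?_
      linear_combination -rules i + entry m (i + 1) j * ih

end IsInfiniteFrieze

namespace Strip

/-- The determinant of two vectors in the plane. -/
def det {R : Type*} [CommRing R] (v w : R × R) : R := v.1 * w.2 - v.2 * w.1

section det

variable {R : Type*} [CommRing R]

theorem det_self (v : R × R) : det v v = 0 := by unfold det; ring

theorem det_swap (v w : R × R) : det w v = -det v w := by unfold det; ring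

theorem det_neg_left (v w : R × R) : det (-v) w = -det v w := by
  simp only [det, Prod.fst_neg, Prod.snd_neg]; ring

theorem det_neg_right (v w : R × R) : det v (-w) = -det v w := by
  simp only [det, Prod.fst_neg, Prod.snd_neg]; ring

theorem det_sub_right (u v w : R × R) : det u (v - w) = det u v - det u w := by
  simp only [det, Prod.fst_sub, Prod.snd_sub]; ring

theorem det_smul_right (c : R) (v w : R × R) : det v (c • w) = c * det v w := by
  simp only [det, Prod.smul_fst, Prod.smul_snd, smul_eq_mul]; ring

theorem det_ptolemy (a b c d : R × R) :
    det a b * det c d = det a c * det b d + det a d * det c b := by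
  unfold det; ring

theorem eq_smul_sub_smul_of_det_eq_one {u v : R × R} (h : det u v = 1) (w : R × R) :
    w = det u w • v - det v w • u := by
  unfold det at *
  ext
  · simp only [Prod.fst_sub, Prod.smul_fst, smul_eq_mul]; linear_combination (-w.1) * h
  · simp only [Prod.snd_sub, Prod.smul_snd, smul_eq_mul]; linear_combination (-w.2) * h

theorem isCoprime_of_det_eq_one {v w : R × R} (h : det v w = 1) : IsCoprime w.1 w.2 :=
  ⟨-v.2, v.1, by rw [← h]; unfold det; ring⟩

end det

theorem eq_zero_of_recurrence {R : Type*} [Ring R] {f a : ℤ → R}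
    (h : ∀ j, f (j + 1) + f (j - 1) = a j * f j) (h0 : f 0 = 0) (h1 : f 1 = 0) (j : ℤ) :
    f j = 0 := by
  suffices f j = 0 ∧ f (j + 1) = 0 from this.1
  induction j using Int.induction_on with
  | zero => exact ⟨h0, by simpa using h1⟩
  | succ n ih =>
    refine ⟨ih.2, ?_⟩
    simpa [ih.1, ih.2] using h (n + 1)
  | pred n ih =>
    have := h (-n)
    exact ⟨by simpa [ih.1, ih.2] using h (-n), by simpa using ih.1⟩

open IsInfiniteFrieze (entry)

variable {m : ℤ → ℤ → ℤ}

/-- The vectors in the lattice `ℤ²` whose pairwise determinants are the entries of the frieze,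
normalized so that `friezeVec m 0 = (1, 0)` and `friezeVec m 1 = (0, 1)`. -/
def friezeVec (m : ℤ → ℤ → ℤ) (j : ℤ) : ℤ × ℤ := (entry m j 1, entry m 0 j)

theorem friezeVec_zero (hm : IsInfiniteFrieze m) : friezeVec m 0 = (1, 0) := by
  simpa [friezeVec, hm.entry_self] using hm.entry_succ 0

theorem det_friezeVec (hm : IsInfiniteFrieze m) (i j : ℤ) :
    det (friezeVec m i) (friezeVec m j) = entry m i j := by
  have h01 : entry m 0 1 = 1 := by simpa using hm.entry_succ 0
  rw [← sub_eq_zero]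
  refine eq_zero_of_recurrence
    (f := fun j => det (friezeVec m i) (friezeVec m j) - entry m i j)
    (a := fun j => m j j) (fun j => ?_) ?_ ?_ j
  · simp only [det, friezeVec]
    rw [hm.entry_swap 1 (j + 1), hm.entry_swap 1 (j - 1), hm.entry_swap 1 j]
    linear_combination entry m i 1 * hm.entry_recurrence 0 j +
      entry m 0 i * hm.entry_recurrence 1 j - hm.entry_recurrence i j
  · simp only [det, friezeVec, hm.entry_self, h01]
    rw [hm.entry_swap 0 i]; ring
  · simp only [det, friezeVec, hm.entry_self, h01]
    ring

theorem det_friezeVec_succ (hm : IsInfiniteFrieze m) (i : ℤ) :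
    det (friezeVec m i) (friezeVec m (i + 1)) = 1 := by
  rw [det_friezeVec hm, hm.entry_succ]

theorem friezeVec_sub_one (hm : IsInfiniteFrieze m) (j : ℤ) :
    friezeVec m (j - 1) = m j j • friezeVec m j - friezeVec m (j + 1) := by
  ext
  · simp only [friezeVec, Prod.fst_sub, Prod.smul_fst, smul_eq_mul]
    rw [hm.entry_swap 1 (j + 1), hm.entry_swap 1 (j - 1), hm.entry_swap 1 j]
    linear_combination -hm.entry_recurrence 1 j
  · simp only [friezeVec, Prod.snd_sub, Prod.smul_snd, smul_eq_mul]
    linear_combination hm.entry_recurrence 0 j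

/-- The rational directions that come after the directions of all the vectors of the frieze. They
are the marked points of the upper boundary in the realization of `m`. -/
def upperPoints (m : ℤ → ℤ → ℤ) : Set ℚ :=
  {q | ∀ j, 0 < det (friezeVec m j) (q.num, (q.den : ℤ))}

/-- The marked points of the strip, without the limit points. -/
def IsVertex (m : ℤ → ℤ → ℤ) : Pt → Prop
  | .lower _ => True
  | .upper q => q ∈ upperPoints m
  | .negInf => False
  | .posInf => False

/-- The primitive vector of a marked point; `0` at the limit points. -/
def vertexVec (m : ℤ → ℤ → ℤ) : Pt → ℤ × ℤ
  | .lower j => friezeVec m j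
  | .upper q => (q.num, (q.den : ℤ))
  | .negInf => 0
  | .posInf => 0

theorem IsVertex.available {x : Pt} (h : IsVertex m x) : x.Available (upperPoints m) := by
  cases x with
  | upper q => exact h
  | _ => trivial

theorem det_vertexVec_pos (hm : IsInfiniteFrieze m) {x y : Pt} (hx : IsVertex m x)
    (hy : IsVertex m y) (h : x < y) : 0 < det (vertexVec m x) (vertexVec m y) := by
  rcases x with i | p | _ | _ <;> rcases y with j | q | _ | _
  case lower.lower =>
    simp only [vertexVec, det_friezeVec hm]
    exact hm.entry_pos (lower_lt_lower.1 h)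
  case lower.upper => exact hy i
  case upper.lower => exact absurd h (lower_lt_upper j p).not_gt
  case upper.upper =>
    have := (Rat.lt_iff _ _).1 (upper_lt_upper.1 h)
    simp only [vertexVec, det]
    linarith
  all_goals first | exact hx.elim | exact hy.elim

theorem det_vertexVec_pos_iff (hm : IsInfiniteFrieze m) {x y : Pt} (hx : IsVertex m x)
    (hy : IsVertex m y) : 0 < det (vertexVec m x) (vertexVec m y) ↔ x < y := by
  refine ⟨fun h => ?_, det_vertexVec_pos hm hx hy⟩
  by_contra! hle
  rcases hle.eq_or_lt with rfl | hlt
  · simp [det_self] at h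
  · have := det_vertexVec_pos hm hy hx hlt
    rw [det_swap] at this; linarith

theorem det_vertexVec_neg_iff (hm : IsInfiniteFrieze m) {x y : Pt} (hx : IsVertex m x)
    (hy : IsVertex m y) : det (vertexVec m x) (vertexVec m y) < 0 ↔ y < x := by
  rw [← det_vertexVec_pos_iff hm hy hx, det_swap (vertexVec m x), Left.neg_pos_iff]

/-- The edges between marked points whose vectors form a basis of the lattice `ℤ²`. -/
def IsFareyEdge (m : ℤ → ℤ → ℤ) (e : Sym2 Pt) : Prop :=
  ∃ x y, e = s(x, y) ∧ IsVertex m x ∧ IsVertex m y ∧ |det (vertexVec m x) (vertexVec m y)| = 1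

theorem isFareyEdge_mk_iff {x y : Pt} : IsFareyEdge m s(x, y) ↔
    IsVertex m x ∧ IsVertex m y ∧ |det (vertexVec m x) (vertexVec m y)| = 1 := by
  refine ⟨fun ⟨x', y', h, hx, hy, hdet⟩ => ?_, fun h => ⟨x, y, rfl, h⟩⟩
  rcases Sym2.eq_iff.1 h with ⟨rfl, rfl⟩ | ⟨rfl, rfl⟩
  · exact ⟨hx, hy, hdet⟩
  · exact ⟨hy, hx, by rwa [det_swap, abs_neg]⟩

theorem IsFareyEdge.not_isDiag {e : Sym2 Pt} (h : IsFareyEdge m e) : ¬ e.IsDiag := by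
  obtain ⟨x, y, rfl, -, -, hdet⟩ := h
  rw [Sym2.mk_isDiag_iff]
  rintro rfl
  simp [det_self] at hdet

theorem IsFareyEdge.available {e : Sym2 Pt} (h : IsFareyEdge m e) :
    ∀ x ∈ e, x.Available (upperPoints m) := by
  obtain ⟨x, y, rfl, hx, hy, -⟩ := h
  intro z hz
  rcases Sym2.mem_iff.1 hz with rfl | rfl
  · exact hx.available
  · exact hy.available

theorem IsFareyEdge.not_crosses (hm : IsInfiniteFrieze m) {e f : Sym2 Pt} (he : IsFareyEdge m e)
    (hf : IsFareyEdge m f) : ¬ Crosses e f := by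
  intro h
  obtain ⟨x, u, y, v, hxu, huy, hyv, hef⟩ := h.exists_lt
  obtain ⟨hxy, huv⟩ : IsFareyEdge m s(x, y) ∧ IsFareyEdge m s(u, v) := by
    rcases hef with ⟨rfl, rfl⟩ | ⟨rfl, rfl⟩
    · exact ⟨he, hf⟩
    · exact ⟨hf, he⟩
  obtain ⟨hx, hy, dxy⟩ := isFareyEdge_mk_iff.1 hxy
  obtain ⟨hu, hv, duv⟩ := isFareyEdge_mk_iff.1 huv
  rw [abs_of_pos (det_vertexVec_pos hm hx hy (hxu.trans huy))] at dxy
  rw [abs_of_pos (det_vertexVec_pos hm hu hv (huy.trans hyv))] at duv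
  -- Both products on the right of Ptolemy's relation are positive integers.
  have ptolemy := det_ptolemy (vertexVec m x) (vertexVec m y) (vertexVec m u) (vertexVec m v)
  have h₁ := mul_pos (det_vertexVec_pos hm hx hu hxu) (det_vertexVec_pos hm hy hv hyv)
  have h₂ := mul_pos (det_vertexVec_pos hm hx hv (hxu.trans (huy.trans hyv)))
    (det_vertexVec_pos hm hu hy huy)
  rw [dxy, duv] at ptolemy
  linarith

theorem exists_triangulation_of_frieze (hm : IsInfiniteFrieze m) :
    ∃ T, IsTriangulation (upperPoints m) T ∧
      ∀ e, IsFareyEdge m e → IsSide (upperPoints m) T e :=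
  exists_triangulation_of_not_crosses (S := {e | IsFareyEdge m e})
    (fun _ he => he.not_isDiag) (fun _ he => he.available) fun _ he _ hf => he.not_crosses hm hf

/-- The line spanned by the vector `w` is the one of the marked point `x`: the primitive vector of
`x` is `w` or `-w`. -/
def HasDirection (m : ℤ → ℤ → ℤ) (x : Pt) (w : ℤ × ℤ) : Prop :=
  IsVertex m x ∧ (vertexVec m x = w ∨ vertexVec m x = -w)

theorem hasDirection_lower (m : ℤ → ℤ → ℤ) (i : ℤ) : HasDirection m (.lower i) (friezeVec m i) :=
  ⟨trivial, .inl rfl⟩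

theorem HasDirection.abs_det {x y : Pt} {u v : ℤ × ℤ} (hx : HasDirection m x u)
    (hy : HasDirection m y v) : |det (vertexVec m x) (vertexVec m y)| = |det u v| := by
  rcases hx.2 with hx | hx <;> rcases hy.2 with hy | hy <;>
    simp only [hx, hy, det_neg_left, det_neg_right, abs_neg]

theorem HasDirection.isFareyEdge {x y : Pt} {u v : ℤ × ℤ} (hx : HasDirection m x u)
    (hy : HasDirection m y v) (h : det u v = 1) : IsFareyEdge m s(x, y) :=
  isFareyEdge_mk_iff.2 ⟨hx.1, hy.1, by rw [hx.abs_det hy, h, abs_one]⟩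

theorem HasDirection.unique (hm : IsInfiniteFrieze m) {x y : Pt} {w : ℤ × ℤ}
    (hx : HasDirection m x w) (hy : HasDirection m y w) : x = y := by
  have h : det (vertexVec m x) (vertexVec m y) = 0 := by
    rw [← abs_eq_zero, hx.abs_det hy, det_self, abs_zero]
  apply le_antisymm
  · exact not_lt.1 fun hlt => ((det_vertexVec_neg_iff hm hx.1 hy.1).2 hlt).ne h
  · exact not_lt.1 fun hlt => ((det_vertexVec_pos_iff hm hx.1 hy.1).2 hlt).ne' h

theorem HasDirection.sbtw (hm : IsInfiniteFrieze m) {x y z : Pt} {u v w : ℤ × ℤ}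
    (hx : HasDirection m x u) (hy : HasDirection m y v) (hz : HasDirection m z w)
    (h : 0 < det u v * det v w * det u w) : sbtw x y z := by
  -- Every vector occurs twice in the product, which therefore does not depend on the signs.
  have h' : 0 < det (vertexVec m x) (vertexVec m y) * det (vertexVec m y) (vertexVec m z) *
      det (vertexVec m x) (vertexVec m z) := by
    rcases hx.2 with hx | hx <;> rcases hy.2 with hy | hy <;> rcases hz.2 with hz | hz <;>
      simpa only [hx, hy, hz, det_neg_left, det_neg_right, neg_mul, mul_neg, neg_neg] using h
  simp only [mul_pos_iff, mul_neg_iff, det_vertexVec_pos_iff hm, det_vertexVec_neg_iff hm,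
    hx.1, hy.1, hz.1] at h'
  rw [sbtw_iff]
  rcases h' with ⟨⟨hxy, hyz⟩ | ⟨hyx, hzy⟩, hxz⟩ | ⟨⟨hxy, -⟩ | ⟨-, hyz⟩, hzx⟩
  · exact .inl ⟨hxy, hyz⟩
  · order
  · exact .inr (.inr ⟨hzx, hxy⟩)
  · exact .inr (.inl ⟨hyz, hzx⟩)

theorem exists_hasDirection_of_forall_det_pos (hm : IsInfiniteFrieze m) {w : ℤ × ℤ}
    (hw : IsCoprime w.1 w.2) (h : ∀ j, 0 < det (friezeVec m j) w) : ∃ x, HasDirection m x w := by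
  have hpos : 0 < w.2 := by simpa [friezeVec_zero hm, det] using h 0
  have hcop := Int.isCoprime_iff_gcd_eq_one.1 hw
  have hvec : vertexVec m (.upper (w.1 / w.2)) = w :=
    Prod.ext (Rat.num_div_eq_of_coprime hpos hcop) (Rat.den_div_eq_of_coprime hpos hcop)
  exact ⟨.upper (w.1 / w.2), fun j => (h j).trans_eq (congrArg _ hvec.symm), .inl hvec⟩

/-- A vector forming a basis of the lattice with the `i`-th vector of the frieze cannot lie
strictly between two other consecutive vectors of the frieze. -/
theorem exists_hasDirection_of_sign_change (hm : IsInfiniteFrieze m) {i j : ℤ} {w : ℤ × ℤ}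
    (hw : det (friezeVec m i) w = 1) (hj : j ≠ i) (hj' : j + 1 ≠ i)
    (h : det (friezeVec m j) w * det (friezeVec m (j + 1)) w ≤ 0) :
    ∃ x, HasDirection m x w := by
  have hcomb := eq_smul_sub_smul_of_det_eq_one (det_friezeVec_succ hm j) w
  set p := det (friezeVec m j) w
  set q := det (friezeVec m (j + 1)) w
  have hsum : p * entry m i (j + 1) - q * entry m i j = 1 := by
    rw [← det_friezeVec hm, ← det_friezeVec hm, ← det_smul_right, ← det_smul_right,
      ← det_sub_right, ← hcomb, hw]
  have hsign := hm.entry_mul_entry_succ_pos hj hj'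
  rcases eq_or_ne p 0 with hp | hp
  · rw [hp] at hsum hcomb
    have hq : q = 1 ∨ q = -1 := Int.eq_one_or_neg_one_of_mul_eq_one
      (show q * -entry m i j = 1 by linarith)
    refine ⟨.lower j, trivial, ?_⟩
    rcases hq with hq | hq <;> rw [hcomb, hq] <;> simp [vertexVec]
  rcases eq_or_ne q 0 with hq | hq
  · rw [hq] at hsum hcomb
    have hp : p = 1 ∨ p = -1 := Int.eq_one_or_neg_one_of_mul_eq_one
      (show p * entry m i (j + 1) = 1 by linarith)
    refine ⟨.lower (j + 1), trivial, ?_⟩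
    rcases hp with hp | hp <;> rw [hcomb, hp] <;> simp [vertexVec]
  -- Otherwise `1` would be the sum of two nonzero integers of the same sign.
  have hlt : p * q < 0 := h.lt_of_ne (mul_ne_zero hp hq)
  have hprod : 0 < (p * entry m i (j + 1)) * -(q * entry m i j) := by
    nlinarith [mul_pos (neg_pos.2 hlt) hsign]
  rcases mul_pos_iff.1 hprod with ⟨h₁, h₂⟩ | ⟨h₁, h₂⟩ <;> omega

/-- The vectors of the neighbours of `(i, 0)`, up to sign. -/
def spokeVec (m : ℤ → ℤ → ℤ) (i k : ℤ) : ℤ × ℤ := friezeVec m (i + 1) - k • friezeVec m i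

theorem spokeVec_zero (m : ℤ → ℤ → ℤ) (i : ℤ) : spokeVec m i 0 = friezeVec m (i + 1) := by
  simp [spokeVec]

theorem spokeVec_quiddity (hm : IsInfiniteFrieze m) (i : ℤ) :
    spokeVec m i (m i i) = -friezeVec m (i - 1) := by
  rw [friezeVec_sub_one hm, neg_sub, spokeVec]

theorem det_friezeVec_spokeVec (hm : IsInfiniteFrieze m) (i k : ℤ) :
    det (friezeVec m i) (spokeVec m i k) = 1 := by
  rw [spokeVec, det_sub_right, det_smul_right, det_self, det_friezeVec_succ hm, mul_zero, sub_zero]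

theorem det_spokeVec (hm : IsInfiniteFrieze m) (i k l : ℤ) :
    det (spokeVec m i k) (spokeVec m i l) = l - k := by
  have h := det_friezeVec_succ hm i
  simp only [det, spokeVec, Prod.fst_sub, Prod.snd_sub, Prod.smul_fst, Prod.smul_snd,
    smul_eq_mul] at *
  linear_combination (l - k) * h

theorem hasDirection_spokeVec_zero (m : ℤ → ℤ → ℤ) (i : ℤ) :
    HasDirection m (.lower (i + 1)) (spokeVec m i 0) :=
  spokeVec_zero m i ▸ hasDirection_lower m (i + 1)

theorem hasDirection_spokeVec_quiddity (hm : IsInfiniteFrieze m) (i : ℤ) :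
    HasDirection m (.lower (i - 1)) (spokeVec m i (m i i)) :=
  ⟨trivial, .inr (by rw [spokeVec_quiddity hm, neg_neg]; rfl)⟩

theorem exists_hasDirection_spokeVec (hm : IsInfiniteFrieze m) (i : ℤ) {k : ℤ} (hk : 0 ≤ k)
    (hk' : k ≤ m i i) : ∃ x, HasDirection m x (spokeVec m i k) := by
  rcases hk.eq_or_lt with rfl | hk
  · exact ⟨_, hasDirection_spokeVec_zero m i⟩
  rcases hk'.eq_or_lt with rfl | hk'
  · exact ⟨_, hasDirection_spokeVec_quiddity hm i⟩
  have hi := det_friezeVec_spokeVec hm i k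
  have hsucc : 0 < det (friezeVec m (i + 1)) (spokeVec m i k) := by
    rw [← spokeVec_zero, det_spokeVec hm, sub_zero]; exact hk
  have hpred : 0 < det (friezeVec m (i - 1)) (spokeVec m i k) := by
    rw [← neg_neg (friezeVec m (i - 1)), ← spokeVec_quiddity hm, det_neg_left, det_spokeVec hm]
    omega
  set w := spokeVec m i k
  by_cases hsame : ∀ j, 0 < det (friezeVec m j) w * det (friezeVec m (j + 1)) w
  · refine exists_hasDirection_of_forall_det_pos hm (isCoprime_of_det_eq_one hi) fun j => ?_
    induction j using Int.inductionOn' (b := i) with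
    | zero => rw [hi]; exact one_pos
    | succ j _ ih => exact (pos_iff_pos_of_mul_pos (hsame j)).1 ih
    | pred j _ ih =>
      have hj := hsame (j - 1)
      rw [sub_add_cancel] at hj
      exact (pos_iff_pos_of_mul_pos hj).2 ih
  · push Not at hsame
    obtain ⟨j, hj⟩ := hsame
    refine exists_hasDirection_of_sign_change hm hi ?_ ?_ hj
    · rintro rfl
      rw [hi] at hj; omega
    · rintro rfl
      rw [hi] at hj; rw [add_sub_cancel_right] at hpred; omega

theorem exists_isFan (hm : IsInfiniteFrieze m) (i : ℤ) :
    ∃ x, IsFan (IsFareyEdge m) i (m i i).toNat x := by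
  have hn : ((m i i).toNat : ℤ) = m i i := Int.toNat_of_nonneg (hm.pos i i le_rfl).le
  have hex (k : ℕ) : ∃ x, k ≤ (m i i).toNat → HasDirection m x (spokeVec m i k) := by
    by_cases hk : k ≤ (m i i).toNat
    · obtain ⟨x, hx⟩ := exists_hasDirection_spokeVec hm i (k := k) (by omega) (by omega)
      exact ⟨x, fun _ => hx⟩
    · exact ⟨.negInf, fun h => absurd h hk⟩
  choose x hx using hex
  have hi := hasDirection_lower m i
  exact ⟨x,
    { first := (hx 0 (Nat.zero_le _)).unique hm (hasDirection_spokeVec_zero m i)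
      last := (hx _ le_rfl).unique hm (hn.symm ▸ hasDirection_spokeVec_quiddity hm i)
      sbtw_of_lt := fun k l hkl hl => hi.sbtw hm (hx k (hkl.le.trans hl)) (hx l hl) <| by
        rw [det_friezeVec_spokeVec hm, det_friezeVec_spokeVec hm, det_spokeVec hm]
        omega
      spoke := fun k hk => hi.isFareyEdge (hx k hk) (det_friezeVec_spokeVec hm i k)
      rim := fun k hk => (hx k hk.le).isFareyEdge (hx (k + 1) hk) <| by
        rw [det_spokeVec hm]; push_cast; ring }⟩

end Strip

theorem theorem5p2 (m : ℤ → ℤ → ℤ) (hm : IsInfiniteFrieze m) :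
    Strip.Realizable (quiddityRow m) := by
  obtain ⟨T, hT, hside⟩ := Strip.exists_triangulation_of_frieze hm
  have hfan (i : ℤ) : ∃ x, Strip.IsFan (Strip.IsSide (Strip.upperPoints m) T) i (m i i).toNat x :=
    (Strip.exists_isFan hm i).imp fun _ h => h.mono hside
  choose x hx using hfan
  refine ⟨Strip.upperPoints m, T, ⟨hT, fun i => (hx i).finite_arcs hT⟩, fun i =>
    ⟨(hx i).finite_trianglesAt hT, ?_⟩⟩
  rw [(hx i).ncard_trianglesAt hT, Int.toNat_of_nonneg (hm.pos i i le_rfl).le, quiddityRow]
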